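/- Let $(G,+)$ be an abelian group and let $f,g,h:G\to\mathbb{C}$ be functions. Write $\mathcal{B}(G)$ for the space of bounded functions $G\to\mathbb{C}$. A function $m:G\to\mathbb{C}$ is called multiplicative if $m(x+y)=m(x)m(y)$ for all $x,y\in G$, and a function $a:G\to\mathbb{C}$ is called additive if $a(x+y)=a(x)+a(y)$ for all $x,y\in G$. Suppose that $f$ and $h$ are linearly independent modulo $\mathcal{B}(G)$, that is, for $\lambda_1,\lambda_2\in\mathbb{C}$, $\lambda_1 f+\lambda_2 h\in\mathcal{B}(G)$ implies $\lambda_1=\lambda_2=0$. Suppose also that the function $$(x,y)\mapsto f(x+y)-f(x)g(y)-g(x)f(y)-h(x)h(y)$$ is bounded on $G\times G$. Then at least one of the following holds. (1) There are a bounded function $b:G\to\mathbb{C}$, constants $\rho\in\mathbb{C}$ and $\lambda\in\mathbb{C}\setminus\{0\}$, and functions $f_0,g_0:G\to\mathbb{C}$ satisfying $f_0(x+y)=f_0(x)f_0(y)-g_0(x)g_0(y)$ for all $x,y\in G$, such that $$f=-\lambda^2f_0+\lambda^2b,\qquad g=\tfrac{1+\rho^2}{2}f_0+\rho g_0+\tfrac{1-\rho^2}{2}b,\qquad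 h=\lambda\rho f_0+\lambda g_0-\lambda\rho b.$$ (2) There are a nonzero bounded multiplicative function $m:G\to\mathbb{C}$, an unbounded multiplicative function $M:G\to\mathbb{C}$, a nonzero additive function $a:G\to\mathbb{C}$, a bounded function $b:G\to\mathbb{C}$, and constants $\beta\in\mathbb{C}$ and $\lambda\in\mathbb{C}\setminus\{0\}$ such that $$f=\lambda^2M+am+b,$$ $$g=\beta\lambda\left(1-\tfrac12\beta\lambda\right)M+(1-\beta\lambda)m-\tfrac12\beta^2am-\tfrac12\beta^2b,$$ $$h=\lambda(1-\beta\lambda)M-\lambda m-\beta am-\beta b.$$ (3) There are a nonzero bounded multiplicative function $m:G\to\mathbb{C}$, additive functions $a,a_1:G\to\mathbb{C}$ with $a\neq0$, a bounded function $b:G\to\mathbb{C}$ and a constant $\beta\in\mathbb{C}$ such that $$f=\tfrac12a^2m+\tfrac12a_1m+b,$$ $$g=-\tfrac14\beta^2a^2m+\beta am-\tfrac14\beta^2a_1m+m-\tfrac12\beta^2b,$$ $$h=-\tfrac12\beta a^2m+am-\tfrac12\beta a_1m-\beta b.$$ (4) There are a nonzero bounded multiplicative function $m:G\to\mathbb{C}$,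 a nonzero additive function $a:G\to\mathbb{C}$, a bounded function $b:G\to\mathbb{C}$ and a constant $\beta\in\mathbb{C}$ such that $$f(x+y)=f(x)m(y)+m(x)f(y)+(a(x)m(x)+b(x))(a(y)m(y)+b(y))\quad\text{for all }x,y\in G,$$ $$g=-\tfrac12\beta^2f+(1+\beta a)m+\beta b,\qquad h=-\beta f+am+b.$$ (5) $f(x+y)=f(x)g(y)+g(x)f(y)+h(x)h(y)$ for all $x,y\in G$. -/

import Mathlib

namespace TrigStability

/-- The linear space `B(X)` of all bounded complex-valued functions on `X`. -/
def boundedFunctions (X : Type*) : Submodule ℂ (X → ℂ) where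
  carrier := {f | ∃ C : ℝ, ∀ x, ‖f x‖ ≤ C}
  add_mem' := by
    rintro f g ⟨C, hC⟩ ⟨D, hD⟩
    exact ⟨C + D, fun x => (norm_add_le _ _).trans (add_le_add (hC x) (hD x))⟩
  zero_mem' := ⟨0, fun x => by simp⟩
  smul_mem' := by
    rintro c f ⟨C, hC⟩
    refine ⟨‖c‖ * C, fun x => ?_⟩
    simpa using mul_le_mul_of_nonneg_left (hC x) (norm_nonneg c)

/-- `F 0, …, F (n - 1)` are linearly independent modulo the linear space `V`: a linear combination
of them belongs to `V` only if all its coefficients vanish. -/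
def LinIndepModulo {X : Type*} (V : Submodule ℂ (X → ℂ)) {n : ℕ} (F : Fin n → X → ℂ) : Prop :=
  ∀ c : Fin n → ℂ, ∑ i, c i • F i ∈ V → ∀ i, c i = 0

/-- Multiplicative functions on an additive group: `m (x + y) = m x * m y`. The zero function is
allowed. -/
def IsMultiplicative {G : Type*} [AddCommGroup G] (m : G → ℂ) : Prop :=
  ∀ x y, m (x + y) = m x * m y

/-- Additive functions: `a (x + y) = a x + a y`. -/
def IsAdditive {G : Type*} [AddCommGroup G] (a : G → ℂ) : Prop :=
  ∀ x y, a (x + y) = a x + a y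

end TrigStability

/-! Comparing the two expansions of `f (x + y + z)` modulo a translation invariant space `V` shows
that an equation `f (x + y) = ∑ uᵢ x * vᵢ y` holding modulo `V`, with `f` among the `uᵢ`, holds
exactly as soon as both families `u` and `v` are linearly independent modulo `V`.

If `g, f, h` are independent modulo bounded functions, this gives the exact sine addition law.
Otherwise `g` is a combination of `f` and `h` up to a bounded function `m`, and completing the
square turns the equation into
`f (x + y) + s ^ 2 * f x * f y = f x * m y + m x * f y + k x * k y` up to a bounded error. For
`s ≠ 0` the pair `m - s ^ 2 * f`, `s * k` satisfies the cosine addition law. For `s = 0` the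
function `m` is multiplicative and `k (x + y) = k x * m y + m x * k y + q * k x * k y` for a
constant `q`; after removing an explicit multiple of `k` (`q ≠ 0`) or of `k ^ 2 / m` (`q = 0`), the
quotient of `f` by `m` is additive up to a bounded error, and Hyers' theorem applies.
-/

namespace TrigStability

section LinearAlgebra

variable {X : Type*} {V : Submodule ℂ (X → ℂ)}

theorem linIndepModulo_iff_linearIndependent {n : ℕ} {F : Fin n → X → ℂ} :
    LinIndepModulo V F ↔ LinearIndependent ℂ fun i => V.mkQ (F i) := by
  simp only [LinIndepModulo, Fintype.linearIndependent_iff, ← map_smul, ← map_sum,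
    ← LinearMap.mem_ker, Submodule.ker_mkQ]

theorem linIndepModulo_pair_iff {f h : X → ℂ} :
    LinIndepModulo V ![f, h] ↔ ∀ a b : ℂ, a • f + b • h ∈ V → a = 0 ∧ b = 0 := by
  simp only [LinIndepModulo, Fin.forall_fin_two, Fin.sum_univ_two, Matrix.cons_val_zero,
    Matrix.cons_val_one]
  exact ⟨fun H a b => by simpa using H ![a, b], fun H c => H (c 0) (c 1)⟩

theorem LinIndepModulo.linearIndependent {n : ℕ} {F : Fin n → X → ℂ}
    (hF : LinIndepModulo V F) : LinearIndependent ℂ F :=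
  LinearIndependent.of_comp V.mkQ (linIndepModulo_iff_linearIndependent.1 hF)

theorem LinIndepModulo.right_notMem {f k : X → ℂ} (hfk : LinIndepModulo V ![f, k]) : k ∉ V :=
  fun hk => one_ne_zero (linIndepModulo_pair_iff.1 hfk 0 1 (by simpa using hk)).2

theorem LinIndepModulo.exists_sub_mem {f g h : X → ℂ} (hfh : LinIndepModulo V ![f, h])
    (hdep : ¬ LinIndepModulo V ![g, f, h]) : ∃ α β : ℂ, g - (α • f + β • h) ∈ V := by
  rw [linIndepModulo_iff_linearIndependent] at hfh hdep
  have hcons : (fun i => V.mkQ (![g, f, h] i)) =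
      Fin.cons (V.mkQ g) fun i => V.mkQ (![f, h] i) := by
    ext i
    fin_cases i <;> rfl
  rw [hcons, linearIndependent_finCons, not_and_not_right] at hdep
  obtain ⟨c, hc⟩ := Submodule.mem_span_range_iff_exists_fun ℂ |>.1 (hdep hfh)
  refine ⟨c 0, c 1, (Submodule.Quotient.eq V).1 ?_⟩
  simpa [Fin.sum_univ_two] using hc.symm

-- Completing the square: with `k = h + β f` the expression `f ⊗ g + g ⊗ f + h ⊗ h` becomes
-- `-s ^ 2 f ⊗ f + f ⊗ m + m ⊗ f + k ⊗ k`.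
theorem LinIndepModulo.exists_normal_form {f g h : X → ℂ} (hfh : LinIndepModulo V ![f, h])
    (hdep : ¬ LinIndepModulo V ![g, f, h]) :
    ∃ (k m : X → ℂ) (β s : ℂ), LinIndepModulo V ![f, k] ∧ m ∈ V ∧
      (∀ x, g x = -((β ^ 2 + s ^ 2) / 2) * f x + β * k x + m x) ∧
      ∀ x, h x = k x - β * f x := by
  obtain ⟨α, β, hm⟩ := hfh.exists_sub_mem hdep
  obtain ⟨s, hs⟩ := IsAlgClosed.exists_pow_nat_eq (β ^ 2 - 2 * α) two_pos
  refine ⟨β • f + h, g - (α • f + β • h), β, s, ?_, hm, fun x => ?_, fun x => ?_⟩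
  · refine linIndepModulo_pair_iff.2 fun a b hab => ?_
    obtain ⟨ha, rfl⟩ := linIndepModulo_pair_iff.1 hfh (a + b * β) b (by convert hab using 1; module)
    simpa using ha
  · simp only [hs, Pi.sub_apply, Pi.add_apply, Pi.smul_apply, smul_eq_mul]
    ring
  · simp

end LinearAlgebra

section Superstability

variable {G : Type*} [AddSemigroup G] {V : Submodule ℂ (G → ℂ)} {n : ℕ} {u v : Fin n → G → ℂ}

theorem translate_mem_span_sup (hright : ∀ φ ∈ V, ∀ y, (fun x => φ (x + y)) ∈ V) {f : G → ℂ}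
    (hv : LinearIndependent ℂ v)
    (hf : ∀ y, (fun x => f (x + y) - ∑ i, u i x * v i y) ∈ V) (i : Fin n) (y : G) :
    (fun x => u i (x + y)) ∈ Submodule.span ℂ (Set.range u) ⊔ V := by
  set W := Submodule.span ℂ (Set.range u) ⊔ V
  let translate : (Fin n → ℂ) →ₗ[ℂ] G → ℂ :=
    LinearMap.funLeft ℂ ℂ (· + y) ∘ₗ Fintype.linearCombination ℂ u
  have hspan : Submodule.span ℂ (Set.range (flip v)) ≤ W.comap translate := by
    rw [Submodule.span_le]
    rintro _ ⟨z, rfl⟩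
    have hsplit : translate (flip v z) = (∑ i, v i (y + z) • u i) +
        ((fun x => f (x + (y + z)) - ∑ i, u i x * v i (y + z)) -
          fun x => f (x + y + z) - ∑ i, u i (x + y) * v i z) := by
      ext x
      simp [translate, Fintype.linearCombination_apply, LinearMap.funLeft_apply, flip, add_assoc,
        mul_comm]
    rw [SetLike.mem_coe, Submodule.mem_comap, hsplit]
    exact add_mem (Submodule.mem_sup_left (sum_mem fun i _ =>
        Submodule.smul_mem _ _ (Submodule.subset_span ⟨i, rfl⟩)))
      (Submodule.mem_sup_right (sub_mem (hf (y + z)) (hright _ (hf z) y)))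
  rw [span_flip_eq_top_iff_linearIndependent.2 hv] at hspan
  have hi : translate (Pi.single i 1) ∈ W := hspan Submodule.mem_top
  simpa [translate, LinearMap.funLeft, Function.comp_def] using hi

theorem LinIndepModulo.exists_translation_matrix
    (hright : ∀ φ ∈ V, ∀ y, (fun x => φ (x + y)) ∈ V) {f : G → ℂ}
    (hu : LinIndepModulo V u) (hv : LinearIndependent ℂ v)
    (hf : ∀ y, (fun x => f (x + y) - ∑ i, u i x * v i y) ∈ V) :
    ∃ K : G → Matrix (Fin n) (Fin n) ℂ,
      (∀ i y, (fun x => u i (x + y) - ∑ j, K y i j * u j x) ∈ V) ∧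
      ∀ j y z, v j (y + z) = ∑ i, v i z * K y i j := by
  have hK (y : G) (i : Fin n) :
      ∃ c : Fin n → ℂ, (fun x => u i (x + y) - ∑ j, c j * u j x) ∈ V := by
    obtain ⟨w, hw, r, hr, hwr⟩ :=
      Submodule.mem_sup.1 (translate_mem_span_sup hright hv hf i y)
    obtain ⟨c, rfl⟩ := (Submodule.mem_span_range_iff_exists_fun ℂ).1 hw
    refine ⟨c, ?_⟩
    convert hr using 1
    ext x
    simp [← congrFun hwr x]
  choose K hK using hK
  refine ⟨K, fun i y => hK y i, fun j y z => ?_⟩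
  -- associativity of `x + y + z`, read as a relation modulo `V` between functions of `x`
  have hrel : ∑ j, (∑ i, v i z * K y i j - v j (y + z)) • u j ∈ V := by
    have hsplit : ∑ j, (∑ i, v i z * K y i j - v j (y + z)) • u j =
        ((fun x => f (x + (y + z)) - ∑ i, u i x * v i (y + z)) -
          fun x => f (x + y + z) - ∑ i, u i (x + y) * v i z) -
        ∑ i, v i z • fun x => u i (x + y) - ∑ j, K y i j * u j x := by
      ext x
      simp only [Finset.sum_apply, Pi.smul_apply, Pi.sub_apply, smul_eq_mul, sub_mul, mul_sub,
        Finset.sum_sub_distrib, Finset.sum_mul, Finset.mul_sum, add_assoc]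
      rw [Finset.sum_comm]
      simp only [mul_comm, mul_left_comm]
      ring
    rw [hsplit]
    exact sub_mem (sub_mem (hf (y + z)) (hright _ (hf z) y))
      (sum_mem fun i _ => V.smul_mem _ (hK y i))
  exact (sub_eq_zero.1 (hu _ hrel j)).symm

theorem LinIndepModulo.addition_formula
    (hright : ∀ φ ∈ V, ∀ y, (fun x => φ (x + y)) ∈ V)
    (hleft : ∀ φ ∈ V, ∀ y, (fun x => φ (y + x)) ∈ V)
    (hu : LinIndepModulo V u) (hv : LinIndepModulo V v) (i₀ : Fin n)
    (hfst : ∀ y, (fun x => u i₀ (x + y) - ∑ i, u i x * v i y) ∈ V)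
    (hsnd : ∀ x, (fun y => u i₀ (x + y) - ∑ i, u i x * v i y) ∈ V) (x y : G) :
    u i₀ (x + y) = ∑ i, u i x * v i y := by
  obtain ⟨K, -, hvK⟩ := hu.exists_translation_matrix hright hv.linearIndependent hfst
  have hexact (i : Fin n) (x y : G) : u i (x + y) = ∑ j, K y i j * u j x := by
    -- the same comparison, now between functions of `z`
    have hrel : ∑ i, (u i (x + y) - ∑ j, K y i j * u j x) • v i ∈ V := by
      have hsplit : ∑ i, (u i (x + y) - ∑ j, K y i j * u j x) • v i =
          (fun z => u i₀ (x + (y + z)) - ∑ i, u i x * v i (y + z)) -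
            fun z => u i₀ (x + y + z) - ∑ i, u i (x + y) * v i z := by
        ext z
        simp only [Finset.sum_apply, Pi.smul_apply, Pi.sub_apply, smul_eq_mul, sub_mul,
          Finset.sum_sub_distrib, hvK _ y z, Finset.sum_mul, Finset.mul_sum, add_assoc]
        rw [Finset.sum_comm]
        simp only [mul_comm, mul_left_comm]
        ring
      rw [hsplit]
      exact sub_mem (hleft _ (hsnd x) y) (hsnd (x + y))
    exact sub_eq_zero.1 (hv _ hrel i)
  have hcoeff (j : Fin n) : K y i₀ j - v j y = 0 := by
    refine hu (fun j => K y i₀ j - v j y) ?_ j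
    convert hfst y using 1
    ext x
    simp [hexact i₀ x y, sub_mul, mul_comm (u _ x)]
  rw [hexact]
  exact Finset.sum_congr rfl fun j _ => by rw [sub_eq_zero.1 (hcoeff j), mul_comm]

end Superstability

section TranslationInvariant

variable {G : Type*} [AddCommSemigroup G] {V : Submodule ℂ (G → ℂ)}

theorem LinIndepModulo.sine_addition {f g h : G → ℂ}
    (hV : ∀ φ ∈ V, ∀ y, (fun x => φ (x + y)) ∈ V) (hgfh : LinIndepModulo V ![g, f, h])
    (hf : ∀ y, (fun x => f (x + y) - f x * g y - g x * f y - h x * h y) ∈ V) (x y : G) :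
    f (x + y) = f x * g y + g x * f y + h x * h y := by
  have hfgh : LinIndepModulo V ![f, g, h] := by
    rw [linIndepModulo_iff_linearIndependent] at hgfh ⊢
    convert hgfh.comp _ (Equiv.swap (0 : Fin 3) 1).injective using 1
    ext i
    fin_cases i <;> rfl
  have hfst (y : G) :
      (fun x => ![g, f, h] 1 (x + y) - ∑ i, ![g, f, h] i x * ![f, g, h] i y) ∈ V := by
    convert hf y using 2 with x
    simp only [Fin.sum_univ_three, Matrix.cons_val]
    ring
  have hsnd (x : G) :
      (fun y => ![g, f, h] 1 (x + y) - ∑ i, ![g, f, h] i x * ![f, g, h] i y) ∈ V := by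
    convert hf x using 2 with y
    simp only [Fin.sum_univ_three, Matrix.cons_val, add_comm x]
    ring
  have := hgfh.addition_formula hV (by simpa only [add_comm] using hV) hfgh 1 hfst hsnd x y
  simp only [Fin.sum_univ_three, Matrix.cons_val] at this
  linear_combination this

theorem LinIndepModulo.cosine_addition {f g : G → ℂ}
    (hV : ∀ φ ∈ V, ∀ y, (fun x => φ (x + y)) ∈ V) (hfg : LinIndepModulo V ![f, g])
    (hf : ∀ y, (fun x => f (x + y) - (f x * f y - g x * g y)) ∈ V) (x y : G) :
    f (x + y) = f x * f y - g x * g y := by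
  have hfg' : LinIndepModulo V ![f, -g] := linIndepModulo_pair_iff.2 fun a b hab => by
    simpa using linIndepModulo_pair_iff.1 hfg a (-b) (by simpa using hab)
  have hfst (y : G) : (fun x => ![f, g] 0 (x + y) - ∑ i, ![f, g] i x * ![f, -g] i y) ∈ V := by
    simpa [Fin.sum_univ_two, ← sub_eq_add_neg] using hf y
  have hsnd (x : G) : (fun y => ![f, g] 0 (x + y) - ∑ i, ![f, g] i x * ![f, -g] i y) ∈ V := by
    simpa [Fin.sum_univ_two, ← sub_eq_add_neg, mul_comm, add_comm] using hf x
  have := hfg.addition_formula hV (by simpa only [add_comm] using hV) hfg' 0 hfst hsnd x y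
  simpa [Fin.sum_univ_two, ← sub_eq_add_neg] using this

theorem LinIndepModulo.reduced_cosine_addition {f k m : G → ℂ} {s : ℂ}
    (hV : ∀ φ ∈ V, ∀ y, (fun x => φ (x + y)) ∈ V) (hs : s ≠ 0)
    (hfk : LinIndepModulo V ![f, k]) (hm : m ∈ V)
    (hf : ∀ y, (fun x =>
      f (x + y) + s ^ 2 * f x * f y - f x * m y - m x * f y - k x * k y) ∈ V) (x y : G) :
    m (x + y) - s ^ 2 * f (x + y) =
      (m x - s ^ 2 * f x) * (m y - s ^ 2 * f y) - s * k x * (s * k y) := by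
  have hind : LinIndepModulo V ![m - s ^ 2 • f, s • k] :=
    linIndepModulo_pair_iff.2 fun a b hab => by
      have hcomb : (-(a * s ^ 2)) • f + (b * s) • k ∈ V := by
        convert V.sub_mem hab (V.smul_mem a hm) using 1
        module
      simpa [hs] using linIndepModulo_pair_iff.1 hfk _ _ hcomb
  refine hind.cosine_addition hV (fun y => ?_) x y
  convert V.sub_mem (V.sub_mem (hV m hm y) (V.smul_mem (s ^ 2) (hf y)))
    (V.smul_mem (m y) hm) using 1
  ext x
  simp only [Pi.smul_apply, Pi.sub_apply, smul_eq_mul]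
  ring

theorem exists_symmetric_addition_formula {k m ν : G → ℂ}
    (hk : ∀ x y, k (x + y) = k x * m y + ν x * k y) :
    ∃ q : ℂ, ∀ x y, k (x + y) = k x * m y + m x * k y + q * k x * k y := by
  by_cases hk0 : ∀ x, k x = 0
  · exact ⟨0, fun x y => by simp [hk0]⟩
  push Not at hk0
  obtain ⟨w, hw⟩ := hk0
  refine ⟨(ν w - m w) / k w, fun x y => ?_⟩
  have hsymm : k w * (ν x - m x) = k x * (ν w - m w) := by
    linear_combination hk w x - hk x w + congrArg k (add_comm x w)
  rw [hk]
  field_simp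
  linear_combination k y * hsymm

end TranslationInvariant

section Coefficient

variable {G : Type*} [AddCommGroup G] {V : Submodule ℂ (G → ℂ)} {f k m : G → ℂ}

theorem LinIndepModulo.coefficient_ne_zero (hfk : LinIndepModulo V ![f, k])
    (hf : ∀ y, (fun x => f (x + y) - f x * m y - m x * f y - k x * k y) ∈ V) : m ≠ 0 := by
  rintro rfl
  refine one_ne_zero (linIndepModulo_pair_iff.1 hfk 1 (-k 0) ?_).1
  convert hf 0 using 1
  ext x
  simp only [Pi.add_apply, Pi.smul_apply, Pi.zero_apply, smul_eq_mul, add_zero]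
  ring

theorem LinIndepModulo.isMultiplicative_of_coefficient_mem
    (hV : ∀ φ ∈ V, ∀ y, (fun x => φ (x + y)) ∈ V) (hfk : LinIndepModulo V ![f, k]) (hm : m ∈ V)
    (hf : ∀ y, (fun x => f (x + y) - f x * m y - m x * f y - k x * k y) ∈ V) :
    IsMultiplicative m ∧ ∃ ν : G → ℂ, ∀ x y, k (x + y) = k x * m y + ν x * k y := by
  have hk_smul {c : ℂ} (hc : c • k ∈ V) : c = 0 := by
    by_contra hc0
    exact hfk.right_notMem ((V.smul_mem_iff hc0).1 hc)
  have hmk : LinearIndependent ℂ ![m, k] := LinearIndependent.pair_iff.2 fun a b hab => by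
    have hb : b = 0 := hk_smul <| by
      rw [eq_neg_of_add_eq_zero_right hab]
      exact V.neg_mem (V.smul_mem a hm)
    exact ⟨by simpa [hb, hfk.coefficient_ne_zero hf] using hab, hb⟩
  have hdefect (y : G) : (fun x => f (x + y) - f x * m y - k x * k y) ∈ V := by
    convert V.add_mem (hf y) (V.smul_mem (f y) hm) using 1
    ext x
    simp only [Pi.add_apply, Pi.smul_apply, smul_eq_mul]
    ring
  obtain ⟨K, hfK, hK⟩ := hfk.exists_translation_matrix hV (f := f) hmk fun y => by
    simpa [Fin.sum_univ_two, sub_sub] using hdefect y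
  have hK_row (y : G) : m y - K y 0 0 = 0 ∧ k y - K y 0 1 = 0 := by
    refine linIndepModulo_pair_iff.1 hfk _ _ ?_
    convert V.sub_mem (hfK 0 y) (hdefect y) using 1
    ext x
    simp only [Fin.sum_univ_two, Matrix.cons_val, Pi.add_apply, Pi.sub_apply, Pi.smul_apply,
      smul_eq_mul]
    ring
  have hmK (y z : G) : m (y + z) = m z * m y + k z * K y 1 0 := by
    simpa [Fin.sum_univ_two, ← sub_eq_zero.1 (hK_row y).1] using hK 0 y z
  have hkK (y z : G) : k (y + z) = m z * k y + k z * K y 1 1 := by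
    simpa [Fin.sum_univ_two, ← sub_eq_zero.1 (hK_row y).2] using hK 1 y z
  have hK_zero (y : G) : K y 1 0 = 0 := hk_smul <| by
    convert V.sub_mem (hV m hm y) (V.smul_mem (m y) hm) using 1
    ext z
    simp only [Pi.smul_apply, Pi.sub_apply, smul_eq_mul]
    rw [add_comm z y, hmK]
    ring
  exact ⟨fun y z => by rw [hmK, hK_zero]; ring, fun y => K y 1 1,
    fun y z => by rw [hkK]; ring⟩

end Coefficient

section Hyers

open Filter Topology

variable {G E : Type*} [AddCommMonoid G] [NormedAddCommGroup E] [NormedSpace ℝ E] [CompleteSpace E]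

theorem exists_addMonoidHom_norm_sub_le {ψ : G → E} {C : ℝ}
    (hψ : ∀ x y, ‖ψ (x + y) - ψ x - ψ y‖ ≤ C) : ∃ a : G →+ E, ∀ x, ‖ψ x - a x‖ ≤ C := by
  let s (x : G) (n : ℕ) : E := ((2 : ℝ) ^ n)⁻¹ • ψ (2 ^ n • x)
  have hstep (x : G) (n : ℕ) : dist (s x n) (s x (n + 1)) ≤ C / 2 / 2 ^ n := by
    have hdiff : s x (n + 1) - s x n = ((2 : ℝ) ^ (n + 1))⁻¹ •
        (ψ (2 ^ n • x + 2 ^ n • x) - ψ (2 ^ n • x) - ψ (2 ^ n • x)) := by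
      simp only [s, pow_succ, mul_two, add_nsmul]
      module
    rw [dist_comm, dist_eq_norm, hdiff, norm_smul, norm_inv, norm_pow, Real.norm_two, div_div,
      ← pow_succ', div_eq_inv_mul]
    gcongr
    exact hψ _ _
  choose a ha using fun x => cauchySeq_tendsto_of_complete (cauchySeq_of_le_geometric_two (hstep x))
  have ha_add (x y : G) : a (x + y) = a x + a y := by
    have hbound (n : ℕ) : ‖s (x + y) n - s x n - s y n‖ ≤ ((2 : ℝ) ^ n)⁻¹ * C := by
      simp only [s, ← smul_sub, norm_smul, norm_inv, norm_pow, Real.norm_two, nsmul_add]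
      gcongr
      exact hψ _ _
    have hzero : Tendsto (fun n : ℕ => ((2 : ℝ) ^ n)⁻¹ * C) atTop (𝓝 0) := by
      simpa using (tendsto_pow_atTop_nhds_zero_of_lt_one (r := (2⁻¹ : ℝ))
        (by norm_num) (by norm_num)).mul_const C
    rw [← sub_eq_zero, ← sub_sub]
    exact tendsto_nhds_unique (((ha (x + y)).sub (ha x)).sub (ha y))
      (squeeze_zero_norm hbound hzero)
  refine ⟨⟨⟨a, by simpa using ha_add 0 0⟩, ha_add⟩, fun x => ?_⟩
  simpa [s, dist_eq_norm] using dist_le_of_le_geometric_two_of_tendsto₀ (hstep x) (ha x)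

end Hyers

section Bounded

variable {X Y : Type*} {u v : X → ℂ}

theorem comp_mem_boundedFunctions (hu : u ∈ boundedFunctions X) (φ : Y → X) :
    (fun y => u (φ y)) ∈ boundedFunctions Y := by
  obtain ⟨C, hC⟩ := hu
  exact ⟨C, fun y => hC (φ y)⟩

theorem mul_mem_boundedFunctions (hu : u ∈ boundedFunctions X) (hv : v ∈ boundedFunctions X) :
    (fun x => u x * v x) ∈ boundedFunctions X := by
  obtain ⟨C, hC⟩ := hu
  obtain ⟨D, hD⟩ := hv
  exact ⟨C * D, fun x => norm_mul_le_of_le (hC x) (hD x)⟩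

end Bounded

section BoundedDefect

variable {G : Type*} [AddCommGroup G] {f k m : G → ℂ}

theorem IsMultiplicative.apply_ne_zero (hm : IsMultiplicative m) (hm0 : m ≠ 0) (x : G) :
    m x ≠ 0 := by
  intro hx
  refine hm0 (funext fun y => ?_)
  rw [← add_sub_cancel x y, hm, hx, zero_mul, Pi.zero_apply]

theorem IsMultiplicative.inv_mem_boundedFunctions (hm : IsMultiplicative m) (hm0 : m ≠ 0)
    (hmb : m ∈ boundedFunctions G) : (fun x => (m x)⁻¹) ∈ boundedFunctions G := by
  have hone : m 0 = 1 := by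
    simpa [hm.apply_ne_zero hm0 0] using hm 0 0
  convert comp_mem_boundedFunctions hmb (fun x => -x) using 2 with x
  exact inv_eq_of_mul_eq_one_right (by rw [← hm, add_neg_cancel, hone])

theorem IsMultiplicative.exists_additive_add_bounded {φ : G → ℂ} (hm : IsMultiplicative m)
    (hm0 : m ≠ 0) (hmb : m ∈ boundedFunctions G)
    (hφ : (fun p : G × G => φ (p.1 + p.2) - φ p.1 * m p.2 - m p.1 * φ p.2) ∈
      boundedFunctions (G × G)) :
    ∃ a b : G → ℂ, IsAdditive a ∧ b ∈ boundedFunctions G ∧ ∀ x, φ x = a x * m x + b x := by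
  have hne := hm.apply_ne_zero hm0
  obtain ⟨C, hC⟩ := mul_mem_boundedFunctions hφ
    (comp_mem_boundedFunctions (hm.inv_mem_boundedFunctions hm0 hmb) fun p : G × G => p.1 + p.2)
  -- the Cauchy difference of `φ / m` is bounded
  obtain ⟨a, ha⟩ := exists_addMonoidHom_norm_sub_le (ψ := fun x => φ x / m x) (C := C) fun x y => by
    have hquot : φ (x + y) / m (x + y) - φ x / m x - φ y / m y =
        (φ (x + y) - φ x * m y - m x * φ y) * (m (x + y))⁻¹ := by
      rw [hm]
      field [hne x, hne y]
    rw [hquot]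
    exact hC (x, y)
  refine ⟨a, fun x => (φ x / m x - a x) * m x, map_add a,
    mul_mem_boundedFunctions ⟨C, ha⟩ hmb, fun x => ?_⟩
  simp only [sub_mul, div_mul_cancel₀ _ (hne x), add_sub_cancel]

theorem LinIndepModulo.exists_exponential_form {q : ℂ} (hq : q ≠ 0)
    (hfk : LinIndepModulo (boundedFunctions G) ![f, k]) (hm : IsMultiplicative m) (hm0 : m ≠ 0)
    (hmb : m ∈ boundedFunctions G)
    (hk : ∀ x y, k (x + y) = k x * m y + m x * k y + q * k x * k y)
    (hf : (fun p : G × G => f (p.1 + p.2) - f p.1 * m p.2 - m p.1 * f p.2 - k p.1 * k p.2) ∈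
      boundedFunctions (G × G)) :
    ∃ (M a b : G → ℂ) (l : ℂ), IsMultiplicative M ∧ M ∉ boundedFunctions G ∧
      IsAdditive a ∧ a ≠ 0 ∧ b ∈ boundedFunctions G ∧ l ≠ 0 ∧
      (∀ x, f x = l ^ 2 * M x + a x * m x + b x) ∧ ∀ x, k x = l * M x - l * m x := by
  -- subtracting `k / q` from `f` absorbs the term `k ⊗ k`
  obtain ⟨a, b, ha, hb, hab⟩ :=
    hm.exists_additive_add_bounded (φ := fun x => f x - q⁻¹ * k x) hm0 hmb <| by
      convert hf using 2 with p
      rw [hk]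
      field_simp
      ring
  refine ⟨fun x => m x + q * k x, a, fun x => b x - q⁻¹ ^ 2 * m x, q⁻¹, fun x y => ?_,
    fun hM => ?_, ha, ?_, sub_mem hb (Submodule.smul_mem _ (q⁻¹ ^ 2) hmb), inv_ne_zero hq,
    fun x => ?_, fun x => ?_⟩
  · simp only [hk, hm x y]
    ring
  · refine hfk.right_notMem ((Submodule.smul_mem_iff _ hq).1 ?_)
    convert sub_mem hM hmb using 1
    ext x
    simp
  · rintro rfl
    refine one_ne_zero (linIndepModulo_pair_iff.1 hfk 1 (-q⁻¹) ?_).1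
    convert hb using 1
    ext x
    simpa [sub_eq_add_neg] using hab x
  · field_simp
    linear_combination q ^ 2 * hab x + q * (mul_inv_cancel₀ hq) * k x
  · field_simp
    ring

theorem LinIndepModulo.exists_quadratic_form
    (hfk : LinIndepModulo (boundedFunctions G) ![f, k]) (hm : IsMultiplicative m) (hm0 : m ≠ 0)
    (hmb : m ∈ boundedFunctions G) (hk : ∀ x y, k (x + y) = k x * m y + m x * k y)
    (hf : (fun p : G × G => f (p.1 + p.2) - f p.1 * m p.2 - m p.1 * f p.2 - k p.1 * k p.2) ∈
      boundedFunctions (G × G)) :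
    ∃ a a₁ b : G → ℂ, IsAdditive a ∧ a ≠ 0 ∧ IsAdditive a₁ ∧ b ∈ boundedFunctions G ∧
      (∀ x, f x = 1 / 2 * a x ^ 2 * m x + 1 / 2 * a₁ x * m x + b x) ∧ ∀ x, k x = a x * m x := by
  have hne := hm.apply_ne_zero hm0
  obtain ⟨a, hka⟩ : ∃ a : G → ℂ, ∀ x, k x = a x * m x :=
    ⟨fun x => k x / m x, fun x => (div_mul_cancel₀ _ (hne x)).symm⟩
  have ha : IsAdditive a := fun x y => by
    refine mul_right_cancel₀ (hne (x + y)) ?_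
    rw [← hka, hk, hka, hka, hm]
    ring
  -- subtracting `a ^ 2 m / 2` from `f` absorbs the term `k ⊗ k`
  obtain ⟨a₁, b, ha₁, hb, hab⟩ :=
    hm.exists_additive_add_bounded (φ := fun x => f x - 1 / 2 * a x ^ 2 * m x) hm0 hmb <| by
      convert hf using 2 with p
      rw [hka, hka, ha, hm]
      ring
  refine ⟨a, fun x => 2 * a₁ x, b, ha, ?_, fun x y => ?_, hb, fun x => ?_, hka⟩
  · rintro rfl
    refine hfk.right_notMem ?_
    convert (boundedFunctions G).zero_mem using 1
    ext x
    simp [hka]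
  · simp only [ha₁ x y, mul_add]
  · linear_combination hab x

theorem LinIndepModulo.exists_exponential_or_quadratic_form
    (hfk : LinIndepModulo (boundedFunctions G) ![f, k]) (hmb : m ∈ boundedFunctions G)
    (hf : (fun p : G × G => f (p.1 + p.2) - f p.1 * m p.2 - m p.1 * f p.2 - k p.1 * k p.2) ∈
      boundedFunctions (G × G)) :
    IsMultiplicative m ∧ m ≠ 0 ∧
      ((∃ (M a b : G → ℂ) (l : ℂ), IsMultiplicative M ∧ M ∉ boundedFunctions G ∧
        IsAdditive a ∧ a ≠ 0 ∧ b ∈ boundedFunctions G ∧ l ≠ 0 ∧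
        (∀ x, f x = l ^ 2 * M x + a x * m x + b x) ∧ ∀ x, k x = l * M x - l * m x) ∨
      ∃ a a₁ b : G → ℂ, IsAdditive a ∧ a ≠ 0 ∧ IsAdditive a₁ ∧ b ∈ boundedFunctions G ∧
        (∀ x, f x = 1 / 2 * a x ^ 2 * m x + 1 / 2 * a₁ x * m x + b x) ∧
        ∀ x, k x = a x * m x) := by
  have hslice (y : G) := comp_mem_boundedFunctions hf fun x => (x, y)
  have hm0 := hfk.coefficient_ne_zero hslice
  obtain ⟨hm, ν, hν⟩ := hfk.isMultiplicative_of_coefficient_mem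
    (fun _ hφ y => comp_mem_boundedFunctions hφ (· + y)) hmb hslice
  obtain ⟨q, hk⟩ := exists_symmetric_addition_formula hν
  refine ⟨hm, hm0, ?_⟩
  obtain rfl | hq := eq_or_ne q 0
  · exact .inr (hfk.exists_quadratic_form hm hm0 hmb (by simpa using hk) hf)
  · exact .inl (hfk.exists_exponential_form hq hm hm0 hmb hk hf)

end BoundedDefect

end TrigStability

open TrigStability in
theorem proposition3p4_general {G : Type*} [AddCommGroup G] (f g h : G → ℂ)
    (hfh : LinIndepModulo (boundedFunctions G) ![f, h])
    (hbdd : (fun p : G × G =>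
        f (p.1 + p.2) - f p.1 * g p.2 - g p.1 * f p.2 - h p.1 * h p.2) ∈
      boundedFunctions (G × G)) :
    (∃ (f₀ g₀ b : G → ℂ) (ρ l : ℂ),
      b ∈ boundedFunctions G ∧ l ≠ 0 ∧
      (∀ x y, f₀ (x + y) = f₀ x * f₀ y - g₀ x * g₀ y) ∧
      (∀ x, f x = -l ^ 2 * f₀ x + l ^ 2 * b x) ∧
      (∀ x, g x = (1 + ρ ^ 2) / 2 * f₀ x + ρ * g₀ x + (1 - ρ ^ 2) / 2 * b x) ∧
      (∀ x, h x = l * ρ * f₀ x + l * g₀ x - l * ρ * b x)) ∨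
    (∃ (m M a b : G → ℂ) (β l : ℂ),
      IsMultiplicative m ∧ m ≠ 0 ∧ m ∈ boundedFunctions G ∧
      IsMultiplicative M ∧ M ∉ boundedFunctions G ∧
      IsAdditive a ∧ a ≠ 0 ∧ b ∈ boundedFunctions G ∧ l ≠ 0 ∧
      (∀ x, f x = l ^ 2 * M x + a x * m x + b x) ∧
      (∀ x, g x = β * l * (1 - 1 / 2 * β * l) * M x + (1 - β * l) * m x
        - 1 / 2 * β ^ 2 * a x * m x - 1 / 2 * β ^ 2 * b x) ∧
      (∀ x, h x = l * (1 - β * l) * M x - l * m x - β * a x * m x - β * b x)) ∨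
    (∃ (m a a₁ b : G → ℂ) (β : ℂ),
      IsMultiplicative m ∧ m ≠ 0 ∧ m ∈ boundedFunctions G ∧
      IsAdditive a ∧ a ≠ 0 ∧ IsAdditive a₁ ∧ b ∈ boundedFunctions G ∧
      (∀ x, f x = 1 / 2 * a x ^ 2 * m x + 1 / 2 * a₁ x * m x + b x) ∧
      (∀ x, g x = -(1 / 4) * β ^ 2 * a x ^ 2 * m x + β * a x * m x
        - 1 / 4 * β ^ 2 * a₁ x * m x + m x - 1 / 2 * β ^ 2 * b x) ∧
      (∀ x, h x = -(1 / 2) * β * a x ^ 2 * m x + a x * m x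
        - 1 / 2 * β * a₁ x * m x - β * b x)) ∨
    (∀ x y, f (x + y) = f x * g y + g x * f y + h x * h y) := by
  have htranslate : ∀ φ ∈ boundedFunctions G, ∀ y, (fun x => φ (x + y)) ∈ boundedFunctions G :=
    fun _ hφ y => comp_mem_boundedFunctions hφ (· + y)
  have hslice (y : G) := comp_mem_boundedFunctions hbdd fun x => (x, y)
  by_cases hind : LinIndepModulo (boundedFunctions G) ![g, f, h]
  · exact .inr <| .inr <| .inr <| hind.sine_addition htranslate hslice
  obtain ⟨k, m, β, s, hfk, hm, hg, hh⟩ := hfh.exists_normal_form hind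
  obtain rfl | hs := eq_or_ne s 0
  · obtain ⟨hmult, hm0, ⟨M, a, b, l, hM, hM', ha, ha0, hb, hl, hf, hk⟩ |
        ⟨a, a₁, b, ha, ha0, ha₁, hb, hf, hk⟩⟩ :=
      hfk.exists_exponential_or_quadratic_form hm <| by
        convert hbdd using 2
        simp only [hg, hh]
        ring
    · refine .inr <| .inl ⟨m, M, a, b, β, l, hmult, hm0, hm, hM, hM', ha, ha0, hb, hl, hf,
        fun x => ?_, fun x => ?_⟩
      · linear_combination hg x - β ^ 2 / 2 * hf x + β * hk x
      · linear_combination hh x + hk x - β * hf x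
    · refine .inr <| .inr <| .inl ⟨m, a, a₁, b, β, hmult, hm0, hm, ha, ha0, ha₁, hb, hf,
        fun x => ?_, fun x => ?_⟩
      · linear_combination hg x - β ^ 2 / 2 * hf x + β * hk x
      · linear_combination hh x + hk x - β * hf x
  · have hcos := hfk.reduced_cosine_addition htranslate hs hm fun y => by
      convert hslice y using 2
      simp only [hg, hh]
      ring
    refine .inl ⟨fun x => m x - s ^ 2 * f x, fun x => s * k x, m, β * s⁻¹, s⁻¹, hm,
      inv_ne_zero hs, hcos, fun x => ?_, fun x => ?_, fun x => ?_⟩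
    · field
    · rw [hg]
      field
    · rw [hh]
      field

theorem proposition3p4 {G : Type*} [AddCommGroup G] (f g h : G → ℂ)
    (hfh : TrigStability.LinIndepModulo (TrigStability.boundedFunctions G) ![f, h])
    (hbdd : (fun p : G × G =>
        f (p.1 + p.2) - f p.1 * g p.2 - g p.1 * f p.2 - h p.1 * h p.2) ∈
      TrigStability.boundedFunctions (G × G)) :
    (∃ (f₀ g₀ b : G → ℂ) (ρ l : ℂ),
      b ∈ TrigStability.boundedFunctions G ∧ l ≠ 0 ∧
      (∀ x y, f₀ (x + y) = f₀ x * f₀ y - g₀ x * g₀ y) ∧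
      (∀ x, f x = -l ^ 2 * f₀ x + l ^ 2 * b x) ∧
      (∀ x, g x = (1 + ρ ^ 2) / 2 * f₀ x + ρ * g₀ x + (1 - ρ ^ 2) / 2 * b x) ∧
      (∀ x, h x = l * ρ * f₀ x + l * g₀ x - l * ρ * b x)) ∨
    (∃ (m M a b : G → ℂ) (β l : ℂ),
      TrigStability.IsMultiplicative m ∧ m ≠ 0 ∧ m ∈ TrigStability.boundedFunctions G ∧
      TrigStability.IsMultiplicative M ∧ M ∉ TrigStability.boundedFunctions G ∧
      TrigStability.IsAdditive a ∧ a ≠ 0 ∧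
      b ∈ TrigStability.boundedFunctions G ∧ l ≠ 0 ∧
      (∀ x, f x = l ^ 2 * M x + a x * m x + b x) ∧
      (∀ x, g x = β * l * (1 - 1 / 2 * β * l) * M x + (1 - β * l) * m x
        - 1 / 2 * β ^ 2 * a x * m x - 1 / 2 * β ^ 2 * b x) ∧
      (∀ x, h x = l * (1 - β * l) * M x - l * m x - β * a x * m x - β * b x)) ∨
    (∃ (m a a₁ b : G → ℂ) (β : ℂ),
      TrigStability.IsMultiplicative m ∧ m ≠ 0 ∧ m ∈ TrigStability.boundedFunctions G ∧
      TrigStability.IsAdditive a ∧ a ≠ 0 ∧ TrigStability.IsAdditive a₁ ∧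
      b ∈ TrigStability.boundedFunctions G ∧
      (∀ x, f x = 1 / 2 * a x ^ 2 * m x + 1 / 2 * a₁ x * m x + b x) ∧
      (∀ x, g x = -(1 / 4) * β ^ 2 * a x ^ 2 * m x + β * a x * m x
        - 1 / 4 * β ^ 2 * a₁ x * m x + m x - 1 / 2 * β ^ 2 * b x) ∧
      (∀ x, h x = -(1 / 2) * β * a x ^ 2 * m x + a x * m x
        - 1 / 2 * β * a₁ x * m x - β * b x)) ∨
    (∃ (m a b : G → ℂ) (β : ℂ),
      TrigStability.IsMultiplicative m ∧ m ≠ 0 ∧ m ∈ TrigStability.boundedFunctions G ∧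
      TrigStability.IsAdditive a ∧ a ≠ 0 ∧
      b ∈ TrigStability.boundedFunctions G ∧
      (∀ x y, f (x + y) = f x * m y + m x * f y + (a x * m x + b x) * (a y * m y + b y)) ∧
      (∀ x, g x = -(1 / 2) * β ^ 2 * f x + (1 + β * a x) * m x + β * b x) ∧
      (∀ x, h x = -β * f x + a x * m x + b x)) ∨
    (∀ x y, f (x + y) = f x * g y + g x * f y + h x * h y) := by
  exact (proposition3p4_general f g h hfh hbdd).imp_right (Or.imp_right (Or.imp_right Or.inr))
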